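/- Consider undirected graphs $G$ on a finite nonempty vertex set $V$ with nonnegative edge weights, self-loops allowed, in which every vertex has positive weighted degree. Let $\tilde A$ be the weighted adjacency matrix of $G$, $D$ the diagonal matrix of weighted degrees (row sums of $\tilde A$), and $\lambda_1,\dots,\lambda_N$ ($N=|V|$) the eigenvalues of the normalized adjacency matrix $D^{-1/2}\tilde A D^{-1/2}$, with multiplicity. The spectral density of $G$ is the probability distribution $\frac1N\sum_{i=1}^N\delta_{\lambda_i}$. A random walk in $G$ moves from $v$ to $v'$ with probability $(D^{-1}\tilde A)(v,v')$; a walk of length $T$ is the list of the $T$ successive vertices visited, including the starting vertex. Let $0<\epsilon<1/2$ and let $m,T$ be nonnegative integers. Suppose that a (randomized) algorithm, for each graph $G$ as above with vertices labeled by a uniformly random bijection $V\to\{1,\dots,N\}$, receives (besides $N$) the full transcripts, that is, the ordered lists of vertex labels, of $m$ independent random walks of length $T$ in $G$, each started at a uniformly random vertex, and outputs a probability distribution on $\mathbb R$. Suppose that for every such $G$ the output is, with probability $>3/4$ over the labeling, the walks and the algorithm's own randomness, within Wasserstein-1 distance $\epsilon$ of the spectral density of $G$. Then $$m\cdot T>\frac1{16}\cdot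 2^{1/(4\epsilon)} .$$ -/

import Mathlib

open MeasureTheory ProbabilityTheory
open scoped ENNReal

noncomputable section

/-- An undirected graph on the vertex set `V` with nonnegative edge weights (self-loops allowed; weight `0`
means that there is no edge). Every vertex has positive degree, so that the normalized adjacency matrix
and the random walk exist. -/
structure WeightedGraph (V : Type) [Fintype V] where
  /-- The weight of the edge between two vertices. -/
  weight : V → V → ℝ
  weight_symm : ∀ u v, weight u v = weight v u
  weight_nonneg : ∀ u v, 0 ≤ weight u v
  degree_pos : ∀ v, 0 < ∑ u, weight v u

namespace WeightedGraph

variable {V : Type} [Fintype V] (G : WeightedGraph V)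

/-- The weighted degree of a vertex. -/
def degree (v : V) : ℝ := ∑ u, G.weight v u

/-- The weighted adjacency matrix `Ã`. -/
def adjacency : Matrix V V ℝ := Matrix.of G.weight

/-- The normalized adjacency matrix `D^(-1/2) Ã D^(-1/2)`. -/
def normalizedAdjacency [DecidableEq V] : Matrix V V ℝ :=
  Matrix.diagonal (fun v => (Real.sqrt (G.degree v))⁻¹) * G.adjacency *
    Matrix.diagonal (fun v => (Real.sqrt (G.degree v))⁻¹)

theorem normalizedAdjacency_isHermitian [DecidableEq V] : G.normalizedAdjacency.IsHermitian := by
  ext u v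
  simp [normalizedAdjacency, adjacency, G.weight_symm u v]
  ring

/-- The spectral density: the uniform distribution on the eigenvalues (with multiplicity) of the
normalized adjacency matrix. -/
def spectralDensity [DecidableEq V] : Measure ℝ :=
  (Fintype.card V : ℝ≥0∞)⁻¹ •
    ∑ i, Measure.dirac (G.normalizedAdjacency_isHermitian.eigenvalues i)

/-- The probability that a random walk at `v` moves to `u`, the `(v, u)` entry of `D⁻¹ Ã`. -/
def stepProb (v u : V) : ℝ := G.weight v u / G.degree v

/-- The probability that a walk started at a uniformly random vertex visits exactly
`x 0, x 1, …, x (T - 1)`, in this order. -/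
def walkProb {T : ℕ} (x : Fin T → V) : ℝ :=
  ∏ t : Fin T,
    if t.val = 0 then (Fintype.card V : ℝ)⁻¹
    else G.stepProb (x ⟨t.val - 1, lt_of_le_of_lt (Nat.sub_le _ _) t.isLt⟩) (x t)

/-- The probability of the transcript `S` (`S i t` is the label of the `t`-th vertex on the `i`-th walk)
of `m` independent walks, where the vertices are labeled by a uniformly random permutation `σ`, which is
the same for all the walks. -/
def transcriptProb [DecidableEq V] {m T : ℕ} (S : Fin m → Fin T → V) : ℝ :=
  (Fintype.card (Equiv.Perm V) : ℝ)⁻¹ *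
    ∑ σ : Equiv.Perm V, ∏ i, G.walkProb (fun t => σ.symm (S i t))

end WeightedGraph

/-- The Wasserstein-1 distance of two distributions on the real line: the infimum of the transport cost
over all couplings. -/
def wassersteinOne (μ ν : Measure ℝ) : ℝ≥0∞ :=
  ⨅ ψ ∈ {ψ : Measure (ℝ × ℝ) | ψ.map Prod.fst = μ ∧ ψ.map Prod.snd = ν},
    ∫⁻ z, edist z.1 z.2 ∂ψ

/-- A randomized algorithm that reads the transcript of `m` walks with `T` vertices each in a graph whose
vertices are labeled by `Fin N`, and returns a probability distribution on the real line:
`alg S` is the law of the output on the transcript `S`. -/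
abbrev TranscriptAlgorithm (m T N : ℕ) : Type :=
  Kernel (Fin m → Fin T → Fin N) (ProbabilityMeasure ℝ)

/-- The probability, over the labeling, the walks and the internal randomness, that the output of the
algorithm is within Wasserstein-1 distance `ε` of the spectral density of `G`. -/
def successProb {m T N : ℕ} (alg : TranscriptAlgorithm m T N) (G : WeightedGraph (Fin N)) (ε : ℝ) : ℝ :=
  ∑ S : Fin m → Fin T → Fin N, G.transcriptProb S *
    (alg S).real {q | wassersteinOne (q : Measure ℝ) G.spectralDensity ≤ ENNReal.ofReal ε}

end

/-! Two graphs with separated spectra produce nearly the same labeled transcripts. On `ZMod K × ZMod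
(2 * L)`, translation by `(0, 2)` gives `2 * K` cycles of length `L` and translation by `(0, 1)`
gives `K` cycles of length `2 * L`. Each is mixed with a complete graph so that a step jumps to a
uniform vertex with probability `1/2` and otherwise moves along the cycle, with equal chances for
both directions.

Spectra: apart from the common eigenvalue `1`, the mixing halves the cycle eigenvalues `cos (j π /
L)`. A 1-Lipschitz sawtooth turning at these points turns the difference of the two spectral sums
into a telescoping sum, so the integrals differ by `1 / (2 * L)`
(`exists_lipschitz_separating_permGraph`). This exceeds `2 * ε` when `4 * ε * L < 1`, and then no
output is `ε`-close to both densities.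

Transcripts: both graphs are driven by the same uniform seeds. If the seed vertices lie in distinct
blocks `{a} × ZMod (2 * L)` and no walk goes `L` steps without a jump, no walk can notice that a
cycle closes. The pattern of repeated vertices is then the same in both graphs
(`IsSpread.position_eq_iff`), and a uniform relabeling leaves nothing but that pattern
(`relabeledMass_eq_of_eq_iff_eq`). A union bound gives such seeds probability at least `1 - m T / 2
^ L - (m T) ^ 2 / K` (`card_filter_isSpread_ge`).

With `L` just below `1 / (4 * ε)` and `K` large, a violated bound makes the shared mass at least
`3/4`. The two success probabilities then sum to at most `5/4`, although each exceeds `3/4`. -/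

/-! ### Two-point argument: separated spectra against shared transcript mass. -/

/-- The easy half of Kantorovich duality. -/
theorem abs_integral_sub_le_of_wassersteinOne_le {f : ℝ → ℝ} (hf : LipschitzWith 1 f) {B : ℝ}
    (hB : ∀ x, |f x| ≤ B) {μ ν : Measure ℝ} [IsFiniteMeasure μ] {ε : ℝ} (hε : 0 ≤ ε)
    (h : wassersteinOne μ ν ≤ ENNReal.ofReal ε) :
    |∫ x, f x ∂μ - ∫ x, f x ∂ν| ≤ ε := by
  rw [← ENNReal.ofReal_le_ofReal_iff hε]
  refine le_trans ?_ h
  refine le_iInf₂ fun ψ ⟨h1, h2⟩ => ?_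
  have : IsFiniteMeasure ψ := by
    refine ⟨?_⟩
    have : ψ Set.univ = μ Set.univ := by
      rw [← h1, Measure.map_apply measurable_fst MeasurableSet.univ, Set.preimage_univ]
    rw [this]
    exact measure_lt_top μ _
  have i1 : Integrable (fun z : ℝ × ℝ => f z.1) ψ :=
    Integrable.of_bound (hf.continuous.comp continuous_fst).aestronglyMeasurable B
      (.of_forall fun z => hB z.1)
  have i2 : Integrable (fun z : ℝ × ℝ => f z.2) ψ :=
    Integrable.of_bound (hf.continuous.comp continuous_snd).aestronglyMeasurable B
      (.of_forall fun z => hB z.2)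
  rw [← h1, ← h2, integral_map measurable_fst.aemeasurable hf.continuous.aestronglyMeasurable,
    integral_map measurable_snd.aemeasurable hf.continuous.aestronglyMeasurable,
    ← integral_sub i1 i2, ← Real.norm_eq_abs, ofReal_norm]
  refine (enorm_integral_le_lintegral_enorm _).trans (lintegral_mono fun z => ?_)
  have := hf z.1 z.2
  simpa [edist_eq_enorm_sub] using this

/-- Wasserstein balls are replaced by the larger sets cut out by `∫ f`, which this makes measurable,
so that the masses of two disjoint ones can be added. -/
theorem measurable_integral_probabilityMeasure {f : ℝ → ℝ} (hf : Continuous f) :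
    Measurable fun q : ProbabilityMeasure ℝ => ∫ x, f x ∂(q : Measure ℝ) := by
  let κ : Kernel (ProbabilityMeasure ℝ) ℝ := ⟨fun q => q, measurable_subtype_coe⟩
  exact (hf.measurable.stronglyMeasurable.integral_kernel (κ := κ)).measurable

/-- An algorithm cannot output, with probability above `3/4`, a distribution near each of two separated
spectral densities if the transcripts of the two graphs share more than half of their mass. -/
theorem successProb_add_le {m T N : ℕ} (alg : TranscriptAlgorithm m T N) [IsMarkovKernel alg]
    (G₁ G₂ : WeightedGraph (Fin N)) {ε : ℝ} (hε : 0 ≤ ε) {f : ℝ → ℝ} (hf : LipschitzWith 1 f) {B : ℝ}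
    (hB : ∀ x, |f x| ≤ B)
    (hsep : 2 * ε < |∫ x, f x ∂G₁.spectralDensity - ∫ x, f x ∂G₂.spectralDensity|)
    (Q : (Fin m → Fin T → Fin N) → ℝ) (hQ₀ : ∀ S, 0 ≤ Q S) (hQ₁ : ∀ S, Q S ≤ G₁.transcriptProb S)
    (hQ₂ : ∀ S, Q S ≤ G₂.transcriptProb S) (h₁ : ∑ S : Fin m → Fin T → Fin N, G₁.transcriptProb S = 1)
    (h₂ : ∑ S : Fin m → Fin T → Fin N, G₂.transcriptProb S = 1) :
    successProb alg G₁ ε + successProb alg G₂ ε ≤ 2 - ∑ S, Q S := by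
  have hsub : ∀ G : WeightedGraph (Fin N),
      {q : ProbabilityMeasure ℝ | wassersteinOne (q : Measure ℝ) G.spectralDensity ≤ ENNReal.ofReal ε} ⊆
      {q : ProbabilityMeasure ℝ | |∫ x, f x ∂(q : Measure ℝ) - ∫ x, f x ∂G.spectralDensity| ≤ ε} :=
    fun G q hq => abs_integral_sub_le_of_wassersteinOne_le hf hB hε hq
  have hα : ∀ S, (alg S).real
        {q : ProbabilityMeasure ℝ | wassersteinOne (q : Measure ℝ) G₁.spectralDensity ≤ ENNReal.ofReal ε} +
      (alg S).real
        {q : ProbabilityMeasure ℝ | wassersteinOne (q : Measure ℝ) G₂.spectralDensity ≤ ENNReal.ofReal ε}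
      ≤ 1 := by
    intro S
    refine (add_le_add (measureReal_mono (hsub G₁)) (measureReal_mono (hsub G₂))).trans ?_
    rw [← measureReal_union]
    · exact measureReal_le_one
    · rw [Set.disjoint_left]
      intro q h1 h2
      simp only [Set.mem_ofPred_eq] at h1 h2
      refine hsep.not_ge ?_
      rw [abs_sub_comm] at h1
      refine (abs_sub_le _ (∫ x, f x ∂(q : Measure ℝ)) _).trans (by linarith)
    · exact measurableSet_le
        ((measurable_integral_probabilityMeasure hf.continuous).sub_const _).abs measurable_const
  have key : ∀ S, G₁.transcriptProb S * (alg S).real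
        {q : ProbabilityMeasure ℝ | wassersteinOne (q : Measure ℝ) G₁.spectralDensity ≤ ENNReal.ofReal ε} +
      G₂.transcriptProb S * (alg S).real
        {q : ProbabilityMeasure ℝ | wassersteinOne (q : Measure ℝ) G₂.spectralDensity ≤ ENNReal.ofReal ε}
      ≤ G₁.transcriptProb S + G₂.transcriptProb S - Q S := by
    intro S
    have a0 := hα S
    set a := (alg S).real
        {q : ProbabilityMeasure ℝ | wassersteinOne (q : Measure ℝ) G₁.spectralDensity ≤ ENNReal.ofReal ε}
    set b := (alg S).real
        {q : ProbabilityMeasure ℝ | wassersteinOne (q : Measure ℝ) G₂.spectralDensity ≤ ENNReal.ofReal ε}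
    have ha : 0 ≤ a := measureReal_nonneg
    have hb : 0 ≤ b := measureReal_nonneg
    -- The three products add up exactly to the right side minus the left side.
    nlinarith [mul_nonneg (sub_nonneg.2 (hQ₁ S)) (by linarith : 0 ≤ 1 - a),
      mul_nonneg (sub_nonneg.2 (hQ₂ S)) (by linarith : 0 ≤ 1 - b),
      mul_nonneg (hQ₀ S) (by linarith : 0 ≤ 1 - (a + b))]
  calc successProb alg G₁ ε + successProb alg G₂ ε
      ≤ ∑ S, (G₁.transcriptProb S + G₂.transcriptProb S - Q S) := by
        rw [successProb, successProb, ← Finset.sum_add_distrib]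
        exact Finset.sum_le_sum fun S _ => key S
    _ = 2 - ∑ S, Q S := by
        rw [Finset.sum_sub_distrib, Finset.sum_add_distrib, h₁, h₂]; norm_num

namespace WeightedGraph

theorem integral_spectralDensity {V : Type} [Fintype V] [DecidableEq V] (G : WeightedGraph V)
    (f : ℝ → ℝ) :
    ∫ x, f x ∂G.spectralDensity =
      (Fintype.card V : ℝ)⁻¹ * ∑ i, f (G.normalizedAdjacency_isHermitian.eigenvalues i) := by
  rw [spectralDensity, integral_smul_measure, integral_finsetSum_measure]
  · simp
  · intro i _
    exact integrable_dirac (by simp)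

end WeightedGraph

/-! ### The sawtooth test function. -/

noncomputable section

/-- The function that vanishes at `0` and has slope `± 1` on `[-1, 1]`, alternating at the points
`cos (j π / L)`, and slope `0` elsewhere. -/
def chebyshevSawtooth (L : ℕ) (x : ℝ) : ℝ :=
  ∫ t in (0 : ℝ)..x, (SignType.sign (Real.sin (L * Real.arccos t)) : ℝ)

end

theorem measurable_chebyshevSlope (L : ℕ) :
    Measurable fun t : ℝ => ((SignType.sign (Real.sin (L * Real.arccos t)) : SignType) : ℝ) := by
  have h1 : Measurable fun t : ℝ => Real.sin (L * Real.arccos t) := by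
    exact Real.measurable_sin.comp (Real.continuous_arccos.measurable.const_mul _)
  have h2 : Measurable fun x : ℝ => ((SignType.sign x : SignType) : ℝ) := by
    have : (fun x : ℝ => ((SignType.sign x : SignType) : ℝ)) =
        fun x => if 0 < x then 1 else if x < 0 then -1 else 0 := by
      ext x
      rw [sign_apply]
      split_ifs <;> simp
    rw [this]
    exact Measurable.ite measurableSet_Ioi measurable_const
      (Measurable.ite measurableSet_Iio measurable_const measurable_const)
  exact h2.comp h1

theorem abs_signType_le (s : SignType) : |(s : ℝ)| ≤ 1 := by
  cases s <;> simp

theorem intervalIntegrable_chebyshevSlope (L : ℕ) (a b : ℝ) :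
    IntervalIntegrable (fun t : ℝ => ((SignType.sign (Real.sin (L * Real.arccos t)) : SignType) : ℝ))
      volume a b := by
  refine (intervalIntegrable_const (c := (1 : ℝ))).mono_fun
    (measurable_chebyshevSlope L).aestronglyMeasurable (.of_forall fun t => ?_)
  simpa using abs_signType_le _

theorem chebyshevSawtooth_sub (L : ℕ) (a b : ℝ) :
    chebyshevSawtooth L b - chebyshevSawtooth L a =
      ∫ t in a..b, (SignType.sign (Real.sin (L * Real.arccos t)) : ℝ) :=
  intervalIntegral.integral_interval_sub_left (intervalIntegrable_chebyshevSlope L 0 b)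
    (intervalIntegrable_chebyshevSlope L 0 a)

theorem lipschitzWith_chebyshevSawtooth (L : ℕ) : LipschitzWith 1 (chebyshevSawtooth L) := by
  refine LipschitzWith.of_dist_le_mul fun a b => ?_
  rw [Real.dist_eq, Real.dist_eq, chebyshevSawtooth_sub]
  exact intervalIntegral.norm_integral_le_of_norm_le_const (C := 1)
    fun t _ => (Real.norm_eq_abs _).trans_le (abs_signType_le _)

/-- Outside `[-1, 1]` the value of `arccos` is `0` or `π`, where the sine vanishes, so the slope is
`0`. -/
theorem chebyshevSawtooth_projIcc (L : ℕ) (x : ℝ) :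
    chebyshevSawtooth L x = chebyshevSawtooth L (max (-1) (min 1 x)) := by
  rw [← sub_eq_zero, chebyshevSawtooth_sub]
  rw [intervalIntegral.integral_congr_ae (g := fun _ => (0 : ℝ)), intervalIntegral.integral_zero]
  refine .of_forall fun t ht => ?_
  rw [Set.mem_uIoc] at ht
  have : t ≤ -1 ∨ 1 ≤ t := by
    rcases le_total x (-1) with h | h
    · left
      rw [min_eq_right (by linarith), max_eq_left h] at ht
      rcases ht with ht | ht <;> linarith
    · rcases le_total 1 x with h' | h'
      · right
        rw [min_eq_left h', max_eq_right (by linarith)] at ht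
        rcases ht with ht | ht <;> linarith
      · rw [min_eq_right h', max_eq_right h] at ht
        rcases ht with ht | ht <;> linarith
  rcases this with h | h
  · simp [Real.arccos_of_le_neg_one h, Real.sin_nat_mul_pi]
  · simp [Real.arccos_of_one_le h]

theorem abs_chebyshevSawtooth_le (L : ℕ) (x : ℝ) : |chebyshevSawtooth L x| ≤ 1 := by
  rw [chebyshevSawtooth_projIcc]
  have h := (lipschitzWith_chebyshevSawtooth L).dist_le_mul (max (-1) (min 1 x)) 0
  rw [Real.dist_eq, Real.dist_eq] at h
  simp only [chebyshevSawtooth, intervalIntegral.integral_same, sub_zero, NNReal.coe_one, one_mul] at h ⊢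
  refine h.trans (abs_le.2 ⟨le_max_left _ _, max_le (by norm_num) (min_le_left _ _)⟩)

/-- The slope of the sawtooth is constant between two consecutive points `cos (j π / L)`. -/
theorem chebyshevSawtooth_cos_sub {L : ℕ} (hL : 0 < L) {j : ℕ} (hj : j < L) :
    chebyshevSawtooth L (Real.cos (j * Real.pi / L)) -
      chebyshevSawtooth L (Real.cos ((j + 1 : ℕ) * Real.pi / L)) =
    (-1) ^ j * (Real.cos (j * Real.pi / L) - Real.cos ((j + 1 : ℕ) * Real.pi / L)) := by
  have hL' : (0 : ℝ) < L := by exact_mod_cast hL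
  have hpi := Real.pi_pos
  have hj' : ((j + 1 : ℕ) : ℝ) ≤ L := by exact_mod_cast hj
  have m0 : 0 ≤ j * Real.pi / L := by positivity
  have m1 : j * Real.pi / L ≤ (j + 1 : ℕ) * Real.pi / L := by
    gcongr; simp
  have m2 : (j + 1 : ℕ) * Real.pi / L ≤ Real.pi := by
    rw [div_le_iff₀ hL', mul_comm]; gcongr
  have hc := Real.cos_le_cos_of_nonneg_of_le_pi m0 m2 m1
  rw [chebyshevSawtooth_sub,
    intervalIntegral.integral_congr_Ioo_of_le (g := fun _ => (-1 : ℝ) ^ j) hc]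
  · rw [intervalIntegral.integral_const, smul_eq_mul, mul_comm]
  · intro t ht
    have t1 : t ≤ 1 := ht.2.le.trans (Real.cos_le_one _)
    have t0 : -1 ≤ t := (Real.neg_one_le_cos _).trans ht.1.le
    have ha : j * Real.pi / L < Real.arccos t := by
      rw [← Real.arccos_cos m0 (m1.trans m2)]
      exact Real.strictAntiOn_arccos ⟨t0, t1⟩ ⟨Real.neg_one_le_cos _, Real.cos_le_one _⟩ ht.2
    have hb : Real.arccos t < (j + 1 : ℕ) * Real.pi / L := by
      rw [← Real.arccos_cos (m0.trans m1) m2]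
      exact Real.strictAntiOn_arccos ⟨Real.neg_one_le_cos _, Real.cos_le_one _⟩ ⟨t0, t1⟩ ht.1
    rw [div_lt_iff₀ hL'] at ha
    rw [lt_div_iff₀ hL'] at hb
    push_cast at hb
    have hs : 0 < Real.sin (L * Real.arccos t - j * Real.pi) :=
      Real.sin_pos_of_pos_of_lt_pi (by linarith) (by linarith)
    have he : Real.sin (L * Real.arccos t) =
        (-1) ^ j * Real.sin (L * Real.arccos t - j * Real.pi) := by
      rw [← Real.sin_add_nat_mul_pi, sub_add_cancel]
    simp only [he]
    rcases neg_one_pow_eq_or ℝ j with h | h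
    · simp [h, hs]
    · simp [h, hs]

/-- Folding the second half of the sum by `cos (2π - θ) = cos θ` pairs neighboring points. Each pair
contributes the length of its gap, with the sign cancelled by the slope, and the gaps fill `[-1,
1]`. -/
theorem alternating_sum_chebyshevSawtooth {L : ℕ} (hL : 0 < L) :
    ∑ j ∈ Finset.range (2 * L), (-1) ^ j * chebyshevSawtooth L (Real.cos (j * Real.pi / L)) = 2 := by
  have hL' : (L : ℝ) ≠ 0 := by exact_mod_cast hL.ne'
  have h2 : ∑ j ∈ Finset.range L,
      (-1) ^ (L + j) * chebyshevSawtooth L (Real.cos ((L + j : ℕ) * Real.pi / L)) =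
      ∑ j ∈ Finset.range L,
        -((-1) ^ j * chebyshevSawtooth L (Real.cos ((j + 1 : ℕ) * Real.pi / L))) := by
    rw [← Finset.sum_range_reflect]
    refine Finset.sum_congr rfl fun j hj => ?_
    have hj' : j < L := Finset.mem_range.1 hj
    obtain ⟨k, rfl⟩ : ∃ k, L = j + k + 1 := ⟨L - j - 1, by omega⟩
    have e1 : j + k + 1 - 1 - j = k := by omega
    rw [e1]
    have e2 : (-1 : ℝ) ^ (j + k + 1 + k) = -(-1) ^ j := by
      rw [show j + k + 1 + k = j + 1 + 2 * k by ring, pow_add, pow_mul]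
      simp [pow_succ]
    have e3 : ((j + k + 1 + k : ℕ) : ℝ) * Real.pi / (j + k + 1 : ℕ) =
        2 * Real.pi - (j + 1 : ℕ) * Real.pi / (j + k + 1 : ℕ) := by
      field_simp
      push_cast
      ring
    rw [e2, e3, Real.cos_two_pi_sub, neg_mul]
  rw [two_mul, Finset.sum_range_add, h2, ← Finset.sum_add_distrib]
  calc _ = ∑ j ∈ Finset.range L,
        (Real.cos (j * Real.pi / L) - Real.cos ((j + 1 : ℕ) * Real.pi / L)) := by
        refine Finset.sum_congr rfl fun j hj => ?_
        have h := chebyshevSawtooth_cos_sub hL (Finset.mem_range.1 hj)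
        have hp : (-1 : ℝ) ^ j * (-1) ^ j = 1 := by rw [← mul_pow]; simp
        linear_combination (-1) ^ j * h +
          (Real.cos (j * Real.pi / L) - Real.cos ((j + 1 : ℕ) * Real.pi / L)) * hp
    _ = 2 := by
        rw [Finset.sum_range_sub']
        have : (L : ℝ) * Real.pi / L = Real.pi := by field_simp
        rw [this]
        norm_num

/-- The sums of the sawtooth over the eigenvalues of two cycles of length `L` and over those of one cycle
of length `2 L`. -/
theorem sum_chebyshevSawtooth_cos_two_mul_sub {L : ℕ} (hL : 0 < L) :
    ∑ j ∈ Finset.range (2 * L), (chebyshevSawtooth L (Real.cos ((2 * j : ℕ) * Real.pi / L)) -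
      chebyshevSawtooth L (Real.cos (j * Real.pi / L))) = 2 := by
  have hL' : (L : ℝ) ≠ 0 := by exact_mod_cast hL.ne'
  have hsplit : ∀ (n : ℕ) (a : ℕ → ℝ), ∑ j ∈ Finset.range (2 * n), a j =
      ∑ j ∈ Finset.range n, (a (2 * j) + a (2 * j + 1)) := by
    intro n a
    induction n with
    | zero => simp
    | succ n ih => rw [mul_add, mul_one, Finset.sum_range_succ, Finset.sum_range_succ, ih,
        Finset.sum_range_succ, add_assoc]
  have h1 := alternating_sum_chebyshevSawtooth hL
  rw [hsplit] at h1
  have h2 : ∑ j ∈ Finset.range (2 * L), chebyshevSawtooth L (Real.cos ((2 * j : ℕ) * Real.pi / L)) =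
      2 * ∑ j ∈ Finset.range L, chebyshevSawtooth L (Real.cos ((2 * j : ℕ) * Real.pi / L)) := by
    rw [two_mul, Finset.sum_range_add, two_mul]
    congr 1
    refine Finset.sum_congr rfl fun j _ => ?_
    have : ((2 * (L + j) : ℕ) : ℝ) * Real.pi / L = (2 * j : ℕ) * Real.pi / L + 2 * Real.pi := by
      field_simp
      push_cast
      ring
    rw [this, Real.cos_add_two_pi]
  rw [Finset.sum_sub_distrib, h2, hsplit]
  refine Eq.trans ?_ h1
  rw [two_mul, ← Finset.sum_add_distrib, ← Finset.sum_sub_distrib]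
  refine Finset.sum_congr rfl fun j _ => ?_
  simp only [pow_succ, pow_mul]
  norm_num
  ring

/-! ### Spectra of translation graphs mixed with a complete graph. -/

noncomputable section

/-- The graph in which `v` is joined to `π v` and `π⁻¹ v`, mixed with a complete graph with all weights
equal to `c`. -/
def permGraph {W : Type} [Fintype W] [DecidableEq W] (c : ℝ) (hc : 0 ≤ c) (π : Equiv.Perm W) :
    WeightedGraph W where
  -- The factor `card W` balances the total weight `c * card W` of the complete part, so the walk
  -- jumps with probability `c / (c + 2)`, whatever the number of vertices.
  weight v u := c + Fintype.card W * ((if π v = u then 1 else 0) + (if π u = v then 1 else 0))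
  weight_symm u v := by ring
  weight_nonneg u v := by positivity
  degree_pos v := by
    have : Nonempty W := ⟨v⟩
    have : 0 < ∑ u, ((Fintype.card W : ℝ) * ((if π v = u then 1 else 0) + (if π u = v then 1 else 0))) :=
      Finset.sum_pos' (fun i _ => by positivity) ⟨π v, Finset.mem_univ _, by
        rw [if_pos rfl]; positivity⟩
    refine this.trans_le (Finset.sum_le_sum fun u _ => by linarith)

end

section
variable {W : Type} [Fintype W] [DecidableEq W]

theorem permGraph_degree (c : ℝ) (hc : 0 ≤ c) (π : Equiv.Perm W) (v : W) :
    (permGraph c hc π).degree v = (c + 2) * Fintype.card W := by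
  have h : ∀ u, (π u = v) = (π.symm v = u) := fun u => by
    rw [Equiv.symm_apply_eq]; exact propext eq_comm
  simp only [WeightedGraph.degree, permGraph, h]
  simp [Finset.sum_add_distrib, ← Finset.mul_sum]
  ring

theorem permGraph_normalizedAdjacency_apply (c : ℝ) (hc : 0 ≤ c) (π : Equiv.Perm W) (v u : W) :
    (permGraph c hc π).normalizedAdjacency v u =
      (c + Fintype.card W * ((if π v = u then 1 else 0) + (if π u = v then 1 else 0))) /
        ((c + 2) * Fintype.card W) := by
  have : Nonempty W := ⟨v⟩
  have hW : (0 : ℝ) < Fintype.card W := by exact_mod_cast Fintype.card_pos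
  have h0 : 0 ≤ (c + 2) * Fintype.card W := by positivity
  rw [WeightedGraph.normalizedAdjacency, Matrix.mul_diagonal, Matrix.diagonal_mul, permGraph_degree,
    permGraph_degree, div_eq_inv_mul, mul_right_comm, ← mul_inv, Real.mul_self_sqrt h0]
  rfl

theorem roots_prod_X_sub_C_univ {κ : Type*} [Fintype κ] (a : κ → ℂ) :
    (∏ i, (Polynomial.X - Polynomial.C (a i))).roots = Finset.univ.val.map a := by
  rw [← Polynomial.roots_multiset_prod_X_sub_C (Finset.univ.val.map a), Multiset.map_map]
  rfl

/-- If a real symmetric matrix becomes diagonal in some complex basis, then the diagonal is the list of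
its eigenvalues. -/
theorem Matrix.IsHermitian.sum_eigenvalues_eq_of_basis {ι : Type*} [Fintype ι] [DecidableEq ι]
    {M : Matrix W W ℝ} (hM : M.IsHermitian) (b : Module.Basis ι ℂ (W → ℂ)) (d : ι → ℝ)
    (h : ∀ i, (M.map Complex.ofReal).mulVec (b i) = (d i : ℂ) • b i) (f : ℝ → ℝ) :
    ∑ i, f (hM.eigenvalues i) = ∑ i, f (d i) := by
  have hchar : (M.map Complex.ofReal).charpoly =
      ∏ i, (Polynomial.X - Polynomial.C (d i : ℂ)) := by
    rw [← Matrix.charpoly_toLin', ← LinearMap.charpoly_toMatrix _ b, ← Matrix.charpoly_diagonal]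
    congr 1
    ext i j
    rw [LinearMap.toMatrix_apply, Matrix.toLin'_apply, h, map_smul, Module.Basis.repr_self,
      Matrix.diagonal_apply]
    by_cases hij : i = j
    · subst hij; simp
    · simp [hij]
  have hchar' : (M.map Complex.ofReal).charpoly =
      ∏ i, (Polynomial.X - Polynomial.C (hM.eigenvalues i : ℂ)) := by
    have := Matrix.charpoly_map M Complex.ofRealHom
    rw [hM.charpoly_eq] at this
    simp only [RCLike.ofReal_real_eq_id, id_eq, Polynomial.map_prod, Polynomial.map_sub,
      Polynomial.map_X, Polynomial.map_C] at this
    exact this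
  have hroots : Finset.univ.val.map (fun i => (hM.eigenvalues i : ℂ)) =
      Finset.univ.val.map (fun i => (d i : ℂ)) := by
    have h1 := hchar.symm.trans hchar'
    rw [← roots_prod_X_sub_C_univ, ← roots_prod_X_sub_C_univ, h1]
  have := congrArg (fun s => (s.map fun z : ℂ => f z.re).sum) hroots
  simpa [Multiset.map_map, Function.comp_def] using this

variable {V : Type} [AddCommGroup V] [Fintype V]

/-- The complete part annihilates every nontrivial character, as its values sum to zero. The
translation and its inverse contribute `χ g + χ (-g) = 2 Re (χ g)`. -/
theorem permGraph_mulVec_addChar (c : ℝ) (hc : 0 ≤ c) (π : Equiv.Perm W) (e : W ≃ V) (g : V)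
    (he : ∀ w, e (π w) = e w + g) (χ : AddChar V ℂ) [Decidable (χ = 0)] :
    ((permGraph c hc π).normalizedAdjacency.map Complex.ofReal).mulVec (fun w => χ (e w)) =
      ((((if χ = 0 then c else 0) + 2 * (χ g).re) / (c + 2) : ℝ) : ℂ) • fun w => χ (e w) := by
  ext v
  have : Nonempty W := ⟨v⟩
  have hW : (Fintype.card W : ℂ) ≠ 0 := by exact_mod_cast Fintype.card_ne_zero
  have hc2 : (c : ℂ) + 2 ≠ 0 := by exact_mod_cast (by positivity : c + 2 ≠ 0)
  have hs : ∑ u, χ (e u) = if χ = 0 then (Fintype.card W : ℂ) else 0 := by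
    rw [e.sum_comp (fun x => χ x), AddChar.sum_eq_ite, Fintype.card_congr e]
  have hπ : ∀ u, (π u = v) = (π.symm v = u) := fun u => by
    rw [Equiv.symm_apply_eq]; exact propext eq_comm
  have he' : e (π.symm v) = e v - g := by
    rw [eq_sub_iff_add_eq, ← he, Equiv.apply_symm_apply]
  have hre : (2 * (χ g).re : ℂ) = χ g + χ (-g) := by
    rw [AddChar.map_neg_eq_conj, Complex.add_conj]
    push_cast; ring
  have hterm : ∀ u, ((permGraph c hc π).normalizedAdjacency.map Complex.ofReal) v u * χ (e u) =
      ((c + 2) * Fintype.card W)⁻¹ * (c * χ (e u) + Fintype.card W *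
        ((if π v = u then χ (e u) else 0) + (if π.symm v = u then χ (e u) else 0))) := by
    intro u
    rw [Matrix.map_apply, permGraph_normalizedAdjacency_apply]
    simp only [hπ]
    push_cast
    split_ifs <;> push_cast <;> ring
  simp only [Matrix.mulVec, dotProduct, hterm, Pi.smul_apply, smul_eq_mul]
  rw [← Finset.mul_sum, Finset.sum_add_distrib, ← Finset.mul_sum, ← Finset.mul_sum,
    Finset.sum_add_distrib, Finset.sum_ite_eq, Finset.sum_ite_eq, hs, he, he', sub_eq_add_neg,
    AddChar.map_add_eq_mul, AddChar.map_add_eq_mul]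
  push_cast
  rw [hre]
  have h0 : χ = 0 → χ (e v) = 1 := fun h => by simp [h]
  simp only [Finset.mem_univ, if_true]
  split_ifs with h
  · rw [h0 h]; field_simp
  · field_simp; push_cast; ring

theorem permGraph_sum_eigenvalues (c : ℝ) (hc : 0 ≤ c) (π : Equiv.Perm W) (e : W ≃ V) (g : V)
    (he : ∀ w, e (π w) = e w + g) [DecidableEq (AddChar V ℂ)] (f : ℝ → ℝ) :
    ∑ i, f ((permGraph c hc π).normalizedAdjacency_isHermitian.eigenvalues i) =
      ∑ χ : AddChar V ℂ, f (((if χ = 0 then c else 0) + 2 * (χ g).re) / (c + 2)) := by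
  refine Matrix.IsHermitian.sum_eigenvalues_eq_of_basis _
    ((AddChar.complexBasis V).map (LinearEquiv.funCongrLeft ℂ ℂ e)) _ (fun χ => ?_) f
  have := permGraph_mulVec_addChar c hc π e g he χ
  rw [Module.Basis.map_apply, AddChar.complexBasis_apply]
  exact this

end

/-! ### Explicit characters and separation of the two spectra. -/

/-- The character of `ZMod K × ZMod M` with the given frequencies. -/
noncomputable def zmodProdChar {K M : ℕ} [NeZero K] [NeZero M] (a : ZMod K × ZMod M) :
    AddChar (ZMod K × ZMod M) ℂ :=
  (AddChar.zmodAddEquiv a.1).compAddMonoidHom (AddMonoidHom.fst (ZMod K) (ZMod M)) *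
    (AddChar.zmodAddEquiv a.2).compAddMonoidHom (AddMonoidHom.snd (ZMod K) (ZMod M))

section
variable {K M : ℕ} [NeZero K] [NeZero M]

theorem zmodProdChar_apply (a x : ZMod K × ZMod M) :
    zmodProdChar a x = AddChar.zmodAddEquiv a.1 x.1 * AddChar.zmodAddEquiv a.2 x.2 := rfl

theorem zmodProdChar_injective : Function.Injective (zmodProdChar (K := K) (M := M)) := by
  intro a b h
  have h1 : AddChar.zmodAddEquiv a.1 = AddChar.zmodAddEquiv b.1 := by
    ext x
    simpa [zmodProdChar_apply] using DFunLike.congr_fun h (x, 0)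
  have h2 : AddChar.zmodAddEquiv a.2 = AddChar.zmodAddEquiv b.2 := by
    ext x
    simpa [zmodProdChar_apply] using DFunLike.congr_fun h (0, x)
  exact Prod.ext (AddChar.zmodAddEquiv.injective h1) (AddChar.zmodAddEquiv.injective h2)

theorem zmodProdChar_bijective : Function.Bijective (zmodProdChar (K := K) (M := M)) := by
  exact (Fintype.bijective_iff_injective_and_card _).2 ⟨zmodProdChar_injective, AddChar.card_eq.symm⟩

theorem zmodAddEquiv_zero_apply (x : ZMod M) : AddChar.zmodAddEquiv (0 : ZMod M) x = 1 := by
  rw [map_zero, AddChar.zero_apply]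

theorem zmodProdChar_zero : zmodProdChar (0 : ZMod K × ZMod M) = 0 := by
  ext x
  simp only [zmodProdChar_apply, Prod.fst_zero, Prod.snd_zero, zmodAddEquiv_zero_apply,
    AddChar.zero_apply, mul_one]

theorem zmodAddEquiv_natCast_re (j k : ℕ) :
    (AddChar.zmodAddEquiv (j : ZMod M) (k : ZMod M)).re = Real.cos ((k * j : ℕ) * (2 * Real.pi) / M) := by
  have h := AddChar.zmod_intCast M j k
  simp only [Int.cast_natCast] at h
  rw [AddChar.zmodAddEquiv_apply]
  change ((AddChar.zmod M (j : ZMod M) (k : ZMod M) : Circle) : ℂ).re = _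
  rw [h, Circle.coe_exp, Complex.exp_ofReal_mul_I_re]
  congr 1
  push_cast
  ring

theorem sum_zmod_eq_sum_range (F : ZMod M → ℝ) : ∑ b, F b = ∑ j ∈ Finset.range M, F (j : ℕ) := by
  obtain ⟨n, rfl⟩ : ∃ n, M = n + 1 := Nat.exists_eq_succ_of_ne_zero (NeZero.ne M)
  rw [← Fin.sum_univ_eq_sum_range (fun j => F (j : ZMod (n + 1)))]
  refine Finset.sum_congr rfl fun b _ => ?_
  congr 1
  exact (ZMod.natCast_zmod_val (n := n + 1) b).symm

end

/-- Sums of a function over the spectra of the graphs of the translations by `(0, 2)` and `(0, 1)` of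
`ZMod K × ZMod (2 * L)`. The eigenvalue `1` of the constant vector occurs in both. -/
theorem permGraph_sum_eigenvalues_sub {W : Type} [Fintype W] [DecidableEq W] {K L : ℕ} (hK : 0 < K)
    (hL : 0 < L) (c : ℝ) (hc : 0 ≤ c) (π₁ π₂ : Equiv.Perm W) (e : W ≃ ZMod K × ZMod (2 * L))
    (he₁ : ∀ w, e (π₁ w) = e w + (0, 2)) (he₂ : ∀ w, e (π₂ w) = e w + (0, 1)) (f : ℝ → ℝ) :
    ∑ i, f ((permGraph c hc π₁).normalizedAdjacency_isHermitian.eigenvalues i) -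
        ∑ i, f ((permGraph c hc π₂).normalizedAdjacency_isHermitian.eigenvalues i) =
      K * ∑ j ∈ Finset.range (2 * L), (f (2 / (c + 2) * Real.cos ((2 * j : ℕ) * Real.pi / L)) -
        f (2 / (c + 2) * Real.cos (j * Real.pi / L))) := by
  classical
  have : NeZero K := ⟨hK.ne'⟩
  have : NeZero (2 * L) := ⟨by omega⟩
  have hc2 : c + 2 ≠ 0 := by positivity
  rw [permGraph_sum_eigenvalues c hc π₁ e _ he₁, permGraph_sum_eigenvalues c hc π₂ e _ he₂,
    ← Finset.sum_sub_distrib, ← zmodProdChar_bijective.sum_comp]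
  have hterm : ∀ a : ZMod K × ZMod (2 * L),
      f (((if zmodProdChar a = 0 then c else 0) + 2 * (zmodProdChar a (0, 2)).re) / (c + 2)) -
        f (((if zmodProdChar a = 0 then c else 0) + 2 * (zmodProdChar a (0, 1)).re) / (c + 2)) =
      f (2 / (c + 2) * (AddChar.zmodAddEquiv a.2 ((2 : ℕ) : ZMod (2 * L))).re) -
        f (2 / (c + 2) * (AddChar.zmodAddEquiv a.2 ((1 : ℕ) : ZMod (2 * L))).re) := by
    intro a
    by_cases h : a = 0
    -- For the trivial character both differences vanish, so its eigenvalue can be treated as if it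
    -- were `2 / (c + 2)` instead of `1`.
    · subst h
      simp only [zmodProdChar_zero, Prod.snd_zero, zmodAddEquiv_zero_apply, AddChar.zero_apply, sub_self]
    · have : zmodProdChar a ≠ 0 := fun h' => h (zmodProdChar_injective (h'.trans zmodProdChar_zero.symm))
      simp only [this, if_false, zero_add, zmodProdChar_apply, AddChar.map_zero_eq_one, one_mul,
        mul_div_right_comm, Nat.cast_ofNat, Nat.cast_one]
  simp only [hterm]
  rw [Fintype.sum_prod_type]
  simp only [Finset.sum_const, Finset.card_univ, ZMod.card, nsmul_eq_mul]
  rw [sum_zmod_eq_sum_range]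
  congr 1
  refine Finset.sum_congr rfl fun j _ => ?_
  have hL' : (L : ℝ) ≠ 0 := by exact_mod_cast hL.ne'
  rw [zmodAddEquiv_natCast_re, zmodAddEquiv_natCast_re]
  congr 4
  · push_cast; field_simp
  · push_cast; field_simp

/-- The test function that separates the two spectra. -/
theorem exists_lipschitz_separating_permGraph {W : Type} [Fintype W] [DecidableEq W] {K L : ℕ} (hK : 0 < K)
    (hL : 0 < L) (c : ℝ) (hc : 0 ≤ c) (π₁ π₂ : Equiv.Perm W) (e : W ≃ ZMod K × ZMod (2 * L))
    (he₁ : ∀ w, e (π₁ w) = e w + (0, 2)) (he₂ : ∀ w, e (π₂ w) = e w + (0, 1)) :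
    ∃ f : ℝ → ℝ, LipschitzWith 1 f ∧ (∀ x, |f x| ≤ 1) ∧
      |∫ x, f x ∂(permGraph c hc π₁).spectralDensity - ∫ x, f x ∂(permGraph c hc π₂).spectralDensity| =
        2 / ((c + 2) * L) := by
  have hs0 : 0 < 2 / (c + 2) := by positivity
  have hs1 : 2 / (c + 2) ≤ 1 := by rw [div_le_one (by positivity)]; linarith
  have hc2 : c + 2 ≠ 0 := by positivity
  have hL' : (0 : ℝ) < L := by exact_mod_cast hL
  have hK' : (0 : ℝ) < K := by exact_mod_cast hK
  have hcard : (Fintype.card W : ℝ) = K * (2 * L) := by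
    have : NeZero K := ⟨hK.ne'⟩
    have : NeZero (2 * L) := ⟨by omega⟩
    rw [Fintype.card_congr e]
    simp
  set s := 2 / (c + 2) with hs
  -- The mixing shrinks the cycle eigenvalues by `s`. Rescaling both axes moves the sawtooth's
  -- turning points there and keeps the Lipschitz constant `1`.
  refine ⟨fun x => s * chebyshevSawtooth L (x / s), ?_, fun x => ?_, ?_⟩
  · refine LipschitzWith.of_dist_le_mul fun x y => ?_
    have := (lipschitzWith_chebyshevSawtooth L).dist_le_mul (x / s) (y / s)
    simp only [Real.dist_eq, NNReal.coe_one, one_mul] at this ⊢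
    rw [← sub_div, abs_div, abs_of_pos hs0, le_div_iff₀ hs0] at this
    rw [← mul_sub, abs_mul, abs_of_pos hs0, mul_comm]
    exact this
  · rw [abs_mul, abs_of_pos hs0]
    exact mul_le_one₀ hs1 (abs_nonneg _) (abs_chebyshevSawtooth_le _ _)
  · rw [WeightedGraph.integral_spectralDensity, WeightedGraph.integral_spectralDensity, ← mul_sub,
      permGraph_sum_eigenvalues_sub hK hL c hc π₁ π₂ e he₁ he₂ (fun x => s * chebyshevSawtooth L (x / s))]
    simp only [← hs, mul_div_cancel_left₀ _ hs0.ne', ← mul_sub]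
    rw [← Finset.mul_sum, sum_chebyshevSawtooth_cos_two_mul_sub hL, hcard, abs_of_pos (by positivity), hs]
    field_simp

/-! ### Walks driven by independent uniform seeds. -/

section Displacement

/-- The last time at which a walk whose steps are described by `d` jumps; the first entry says whether the
walk jumps. -/
def lastJump (d : ℕ → Bool × Bool) : ℕ → ℕ
  -- The uniform start counts as a jump, so `d 0` is never read.
  | 0 => 0
  | t + 1 => if (d (t + 1)).1 then t + 1 else lastJump d t

/-- The number of forward steps minus the number of backward steps since the last jump. -/
def displacement (d : ℕ → Bool × Bool) : ℕ → ℤ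
  | 0 => 0
  | t + 1 => if (d (t + 1)).1 then 0 else displacement d t + if (d (t + 1)).2 then 1 else -1

variable (d : ℕ → Bool × Bool)

theorem lastJump_le (t : ℕ) : lastJump d t ≤ t := by
  induction t with
  | zero => simp [lastJump]
  | succ t ih => rw [lastJump]; split_ifs <;> omega

theorem not_jump_of_lastJump_lt {t j : ℕ} (h : lastJump d t < j) (hj : j ≤ t) : (d j).1 = false := by
  induction t with
  | zero => simp [lastJump] at h; omega
  | succ t ih =>
    rw [lastJump] at h
    split_ifs at h with hd
    · omega
    · rcases Nat.lt_or_ge j (t + 1) with h' | h'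
      · exact ih h (by omega)
      · obtain rfl : j = t + 1 := by omega
        simpa using hd

theorem abs_displacement_sub_le {t t' : ℕ} (htt' : t ≤ t') (h : lastJump d t' ≤ t) :
    |displacement d t' - displacement d t| ≤ t' - t := by
  induction t', htt' using Nat.le_induction with
  | base => simp
  | succ k hk ih =>
    rw [lastJump] at h
    split_ifs at h with hd
    · omega
    · have := ih h
      simp only [displacement, hd]
      rw [abs_le] at this ⊢
      push_cast
      split_ifs <;> constructor <;> omega

end Displacement

section Walks
variable {W : Type} {T : ℕ}

/-- One step of the walk in `permGraph 2 _ π`, driven by a uniform element of `W × Bool × Bool`. -/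
def seedStep (π : Equiv.Perm W) (v : W) (a : W × Bool × Bool) : W :=
  if a.2.1 then a.1 else if a.2.2 then π v else π.symm v

/-- The seeds `s` drive the walk `x`. -/
def IsDrivenBy (π : Equiv.Perm W) (s : Fin T → W × Bool × Bool) (x : Fin T → W) (t : Fin T) : Prop :=
  (if t.val = 0 then (s t).1
    else seedStep π (x ⟨t.val - 1, lt_of_le_of_lt (Nat.sub_le _ _) t.isLt⟩) (s t)) = x t

/-- The directions in a list of seeds. -/
def directions (s : Fin T → W × Bool × Bool) (t : ℕ) : Bool × Bool :=
  -- The default is harmless: `lastJump` and `displacement` at time `t` look at no later time.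
  if h : t < T then (s ⟨t, h⟩).2 else (true, true)

/-- The position at time `t` of the walk driven by the seeds `s`. -/
def position (π : Equiv.Perm W) (s : Fin T → W × Bool × Bool) (t : Fin T) : W :=
  (π ^ displacement (directions s) t) (s ⟨lastJump (directions s) t, (lastJump_le _ _).trans_lt t.isLt⟩).1

theorem isDrivenBy_position (π : Equiv.Perm W) (s : Fin T → W × Bool × Bool) (t : Fin T) :
    IsDrivenBy π s (position π s) t := by
  obtain ⟨t, ht⟩ := t
  cases t with
  | zero => simp [IsDrivenBy, position, displacement, lastJump]
  | succ t =>
    have hd : directions s (t + 1) = (s ⟨t + 1, ht⟩).2 := by simp [directions, ht]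
    simp only [IsDrivenBy, position, Nat.add_sub_cancel, Nat.succ_ne_zero, if_false, displacement,
      lastJump, hd, seedStep]
    by_cases h1 : (s ⟨t + 1, ht⟩).2.1 = true
    · simp [h1]
    · by_cases h2 : (s ⟨t + 1, ht⟩).2.2 = true
      · simp [h1, h2, add_comm _ (1 : ℤ), zpow_add]
      · simp [h1, h2, add_comm _ (-1 : ℤ), zpow_add]

/-- The seeds determine the walk recursively. For a prescribed `x`, the left side constrains each
seed separately, which gives the product form of the walk probability. -/
theorem forall_isDrivenBy_iff (π : Equiv.Perm W) (s : Fin T → W × Bool × Bool) (x : Fin T → W) :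
    (∀ t, IsDrivenBy π s x t) ↔ ∀ t, position π s t = x t := by
  refine ⟨fun h => ?_, fun h => by
    have : position π s = x := funext h
    subst this
    exact isDrivenBy_position π s⟩
  rintro ⟨t, ht⟩
  induction t with
  | zero =>
    have h1 := h ⟨0, ht⟩
    have h2 := isDrivenBy_position π s ⟨0, ht⟩
    simp only [IsDrivenBy, if_true] at h1 h2
    rw [← h1, ← h2]
  | succ t ih =>
    have h1 := h ⟨t + 1, ht⟩
    have h2 := isDrivenBy_position π s ⟨t + 1, ht⟩
    simp only [IsDrivenBy, Nat.succ_ne_zero, if_false, Nat.add_sub_cancel] at h1 h2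
    rw [← h1, ← h2, ih]

variable [Fintype W] [DecidableEq W]

/-- The choice `c = 2` makes a jump a fair coin flip, so one step is driven by a uniform vertex and
two fair bits. -/
theorem permGraph_stepProb (π : Equiv.Perm W) (v u : W) :
    (permGraph 2 zero_le_two π).stepProb v u =
      (Finset.univ.filter fun a => seedStep π v a = u).card / Fintype.card (W × Bool × Bool) := by
  have h : ∀ u, (π u = v) = (π.symm v = u) := fun u => by
    rw [Equiv.symm_apply_eq]; exact propext eq_comm
  rw [WeightedGraph.stepProb, permGraph_degree, Finset.card_filter]
  simp only [Fintype.sum_prod_type, Fintype.sum_bool, seedStep, permGraph, h]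
  simp [Finset.sum_add_distrib]
  congr 1
  ring

theorem prod_walkProb_permGraph {m : ℕ} (π : Equiv.Perm W) (x : Fin m → Fin T → W) :
    ∏ i, (permGraph 2 zero_le_two π).walkProb (x i) =
      (Finset.univ.filter fun ω : Fin m × Fin T → W × Bool × Bool =>
        ∀ p : Fin m × Fin T, position π (fun t => ω (p.1, t)) p.2 = x p.1 p.2).card /
        Fintype.card (Fin m × Fin T → W × Bool × Bool) := by
  classical
  have hcond : ∀ ω : Fin m × Fin T → W × Bool × Bool,
      (∀ p : Fin m × Fin T, position π (fun t => ω (p.1, t)) p.2 = x p.1 p.2) ↔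
      ∀ p : Fin m × Fin T, ω p ∈ Finset.univ.filter fun a : W × Bool × Bool =>
        (if p.2.val = 0 then a.1 else seedStep π
          (x p.1 ⟨p.2.val - 1, lt_of_le_of_lt (Nat.sub_le _ _) p.2.isLt⟩) a) = x p.1 p.2 := by
    intro ω
    simp only [Finset.mem_filter, Finset.mem_univ, true_and, Prod.forall]
    exact forall_congr' fun i => (forall_isDrivenBy_iff π (fun t => ω (i, t)) (x i)).symm
  have hset : (Finset.univ.filter fun ω : Fin m × Fin T → W × Bool × Bool =>
        ∀ p : Fin m × Fin T, position π (fun t => ω (p.1, t)) p.2 = x p.1 p.2) =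
      Fintype.piFinset fun p : Fin m × Fin T => Finset.univ.filter fun a : W × Bool × Bool =>
        (if p.2.val = 0 then a.1 else seedStep π
          (x p.1 ⟨p.2.val - 1, lt_of_le_of_lt (Nat.sub_le _ _) p.2.isLt⟩) a) = x p.1 p.2 := by
    ext ω
    rw [Fintype.mem_piFinset, ← hcond]
    simp
  rw [hset, Fintype.card_piFinset, Fintype.card_fun, Nat.cast_prod, Nat.cast_pow,
    ← Finset.card_univ (α := Fin m × Fin T), ← Finset.prod_const, ← Finset.prod_div_distrib,
    Fintype.prod_prod_type]
  refine Finset.prod_congr rfl fun i _ => Finset.prod_congr rfl fun t _ => ?_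
  by_cases ht : t.val = 0
  · simp only [ht, if_true]
    have hW : (Fintype.card W : ℝ) ≠ 0 := by
      have : Nonempty W := ⟨x i t⟩
      exact_mod_cast Fintype.card_ne_zero
    rw [Finset.card_filter]
    simp only [Fintype.sum_prod_type, Fintype.sum_bool]
    simp [Finset.sum_add_distrib]
    field_simp
  · simp only [ht, if_false]
    exact permGraph_stepProb π _ _

end Walks

/-! ### Uniform relabeling forgets all but the repetition pattern. -/

/-- Two lists with the same pattern of repetitions differ by a relabeling. -/
theorem exists_perm_of_eq_iff_eq {ι W : Type*} [Fintype W] (a b : ι → W) (h : ∀ i j, a i = a j ↔ b i = b j) :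
    ∃ τ : Equiv.Perm W, ∀ i, τ (a i) = b i := by
  classical
  let φ : {x // x ∈ Set.range a} → {x // x ∈ Set.range b} := fun x => ⟨b x.2.choose, Set.mem_range_self _⟩
  have hφ : ∀ i, φ ⟨a i, Set.mem_range_self i⟩ = ⟨b i, Set.mem_range_self i⟩ := fun i =>
    Subtype.ext ((h _ _).1 (Set.mem_range_self (f := a) i).choose_spec)
  have hbij : Function.Bijective φ := by
    constructor
    · rintro ⟨_, i, rfl⟩ ⟨_, j, rfl⟩ hij
      rw [hφ, hφ, Subtype.mk_eq_mk] at hij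
      exact Subtype.ext ((h _ _).2 hij)
    · rintro ⟨_, i, rfl⟩
      exact ⟨_, hφ i⟩
  refine ⟨(Equiv.ofBijective φ hbij).extendSubtype, fun i => ?_⟩
  rw [Equiv.extendSubtype_apply_of_mem _ _ (Set.mem_range_self i), Equiv.ofBijective_apply, hφ]

section Labeling
variable {W Ω : Type} [Fintype W] [DecidableEq W] [Fintype Ω] {m T : ℕ}

noncomputable section

/-- The mass of the outcomes `ω ∈ good`, `ω` uniform on `Ω`, in the law of the uniformly relabeled
list `h ω`. -/
def relabeledMass (h : Ω → Fin m × Fin T → W) (good : Finset Ω) (S : Fin m → Fin T → W) : ℝ :=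
  ((Fintype.card (Equiv.Perm W) : ℝ) * Fintype.card Ω)⁻¹ *
    ∑ ω ∈ good, (Finset.univ.filter fun σ : Equiv.Perm W => ∀ p, σ (h ω p) = S p.1 p.2).card

end

theorem relabeledMass_nonneg (h : Ω → Fin m × Fin T → W) (good : Finset Ω) (S : Fin m → Fin T → W) :
    0 ≤ relabeledMass h good S := by
  unfold relabeledMass; positivity

theorem relabeledMass_mono (h : Ω → Fin m × Fin T → W) {s t : Finset Ω} (hst : s ⊆ t)
    (S : Fin m → Fin T → W) : relabeledMass h s S ≤ relabeledMass h t S := by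
  unfold relabeledMass; gcongr

/-- Each outcome together with a labeling produces exactly one transcript. -/
theorem sum_relabeledMass (h : Ω → Fin m × Fin T → W) (good : Finset Ω) :
    ∑ S, relabeledMass h good S = good.card / Fintype.card Ω := by
  have hone : ∀ (ω : Ω) (σ : Equiv.Perm W), (∑ S : Fin m → Fin T → W,
      if ∀ p : Fin m × Fin T, σ (h ω p) = S p.1 p.2 then 1 else 0) = 1 := by
    intro ω σ
    rw [Finset.sum_eq_single fun i t => σ (h ω (i, t))]
    · simp
    · intro S _ hS
      rw [if_neg]
      exact fun h' => hS (funext fun i => funext fun t => (h' (i, t)).symm)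
    · simp
  have hp : (Fintype.card (Equiv.Perm W) : ℝ) ≠ 0 := by exact_mod_cast Fintype.card_ne_zero
  simp only [relabeledMass, ← Finset.mul_sum, Finset.card_filter]
  rw [← Nat.cast_sum, Finset.sum_comm]
  rw [Finset.sum_congr rfl fun ω _ => Finset.sum_comm]
  simp only [hone]
  simp only [Finset.sum_const, Finset.card_univ, smul_eq_mul, mul_one]
  push_cast
  field_simp

/-- For each good outcome some permutation `τ` carries one list to the other, and `σ ↦ σ * τ⁻¹`
matches the labelings that produce `S`. -/
theorem relabeledMass_eq_of_eq_iff_eq (h₁ h₂ : Ω → Fin m × Fin T → W) (good : Finset Ω)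
    (h : ∀ ω ∈ good, ∀ p q, h₁ ω p = h₁ ω q ↔ h₂ ω p = h₂ ω q) (S : Fin m → Fin T → W) :
    relabeledMass h₁ good S = relabeledMass h₂ good S := by
  unfold relabeledMass
  congr 2
  refine Finset.sum_congr rfl fun ω hω => ?_
  obtain ⟨τ, hτ⟩ := exists_perm_of_eq_iff_eq _ _ (h ω hω)
  refine Finset.card_bij' (fun σ _ => σ * τ⁻¹) (fun σ _ => σ * τ) ?_ ?_ ?_ ?_
  · intro σ hσ
    simp only [Finset.mem_filter, Finset.mem_univ, true_and, Equiv.Perm.mul_apply] at hσ ⊢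
    intro p
    rw [← hτ, Equiv.Perm.inv_def, Equiv.symm_apply_apply, hσ]
  · intro σ hσ
    simp only [Finset.mem_filter, Finset.mem_univ, true_and, Equiv.Perm.mul_apply] at hσ ⊢
    intro p
    rw [hτ, hσ]
  · simp
  · simp

theorem transcriptProb_permGraph (π : Equiv.Perm W) (S : Fin m → Fin T → W) :
    (permGraph 2 zero_le_two π).transcriptProb S =
      relabeledMass (fun (ω : Fin m × Fin T → W × Bool × Bool) p => position π (fun t => ω (p.1, t)) p.2)
        Finset.univ S := by
  simp only [WeightedGraph.transcriptProb, relabeledMass, prod_walkProb_permGraph, Finset.card_filter]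
  rw [Finset.sum_comm, ← Finset.sum_div, mul_inv, div_eq_mul_inv, mul_comm (∑ _, _), ← mul_assoc]
  congr 1
  push_cast
  refine Finset.sum_congr rfl fun σ _ => Finset.sum_congr rfl fun ω _ => ?_
  simp only [Equiv.eq_symm_apply]

end Labeling

/-! ### Seeds on which the two graphs look alike. -/

section Good
variable {W ι : Type} {m T : ℕ}

/-- The walks jump to vertices in distinct blocks, and never go `L` steps without a jump. -/
def IsSpread (L : ℕ) (b : W → ι) (ω : Fin m × Fin T → W × Bool × Bool) : Prop :=
  (∀ p q, p ≠ q → b (ω p).1 ≠ b (ω q).1) ∧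
    ∀ p : Fin m × Fin T, p.2.val < L + lastJump (directions fun t => ω (p.1, t)) p.2

theorem zpow_apply_block {b : W → ι} {π : Equiv.Perm W} (hb : ∀ v, b (π v) = b v) (k : ℤ) (v : W) :
    b ((π ^ k) v) = b v := by
  induction k with
  | zero => simp
  | succ k ih => rw [add_comm, zpow_add, Equiv.Perm.mul_apply, zpow_one, hb, ih]
  | pred k ih =>
    rw [sub_eq_neg_add, zpow_add, Equiv.Perm.mul_apply, zpow_neg_one, ← hb, Equiv.Perm.inv_def,
      Equiv.apply_symm_apply, ih]

/-- On spread seeds, whether two positions coincide does not depend on the permutation, as long as it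
preserves the blocks and has no cycle shorter than `L`. -/
theorem IsSpread.position_eq_iff {L : ℕ} {b : W → ι} {ω : Fin m × Fin T → W × Bool × Bool}
    (hω : IsSpread L b ω) {π : Equiv.Perm W} (hb : ∀ v, b (π v) = b v)
    (hπ : ∀ v (k : ℤ), |k| < L → (π ^ k) v = v → k = 0) (p q : Fin m × Fin T) :
    position π (fun t => ω (p.1, t)) p.2 = position π (fun t => ω (q.1, t)) q.2 ↔
      p.1 = q.1 ∧ lastJump (directions fun t => ω (p.1, t)) p.2 =
        lastJump (directions fun t => ω (q.1, t)) q.2 ∧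
        displacement (directions fun t => ω (p.1, t)) p.2 =
          displacement (directions fun t => ω (q.1, t)) q.2 := by
  constructor
  · intro h
    have hblock := congrArg b h
    rw [position, position, zpow_apply_block hb, zpow_apply_block hb] at hblock
    -- Cycle moves stay inside a block, and distinct seeds lie in distinct blocks, so equal
    -- positions come from the same last jump.
    have hidx := by_contra fun hne => hω.1 _ _ hne hblock
    obtain ⟨i, s, hs⟩ := p
    obtain ⟨i', t, ht⟩ := q
    simp only [Prod.mk.injEq, Fin.mk.injEq] at hidx
    obtain ⟨rfl, hl⟩ := hidx
    refine ⟨rfl, hl, ?_⟩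
    simp only [position, hl] at h
    -- Both times follow the same jump by less than `L` steps, so they are less than `L` apart with
    -- no jump between.
    have hdiff : |displacement (directions fun t => ω (i, t)) s -
        displacement (directions fun t => ω (i, t)) t| < L := by
      have hs' := hω.2 (i, ⟨s, hs⟩)
      have ht' := hω.2 (i, ⟨t, ht⟩)
      simp only at hs' ht'
      have hls := lastJump_le (directions fun t => ω (i, t)) s
      have hlt := lastJump_le (directions fun t => ω (i, t)) t
      rcases le_total s t with hst | hst
      · have := abs_displacement_sub_le (directions fun t => ω (i, t)) hst (by omega)
        rw [abs_sub_comm]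
        omega
      · have := abs_displacement_sub_le (directions fun t => ω (i, t)) hst (by omega)
        omega
    have := hπ (ω (i, ⟨lastJump (directions fun t => ω (i, t)) t,
      (lastJump_le _ _).trans_lt ht⟩)).1 _ hdiff (by
        rw [sub_eq_neg_add, zpow_add, Equiv.Perm.mul_apply, h, zpow_neg, Equiv.Perm.inv_def,
          Equiv.symm_apply_apply])
    exact sub_eq_zero.1 this
  · obtain ⟨i, s⟩ := p
    obtain ⟨i', t⟩ := q
    rintro ⟨h1, h2, h3⟩
    simp only at h1 h2 h3
    subst h1
    simp only [position, h2, h3]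

end Good

/-! ### Most seeds are spread. -/

/-- A union bound for a relation between two coordinates of a uniform function. -/
theorem card_filter_rel_mul_le {I A : Type*} [Fintype I] [DecidableEq I] [Fintype A]
    (R : A → A → Prop) [DecidableRel R] {r : ℕ} (hR : ∀ a, (Finset.univ.filter fun a' => R a a').card ≤ r)
    {p q : I} (hpq : p ≠ q) :
    (Finset.univ.filter fun ω : I → A => R (ω p) (ω q)).card * Fintype.card A ≤
      r * Fintype.card (I → A) := by
  let φ := Equiv.funSplitAt q A
  -- With all coordinates but `q` fixed, at most `r` values of `ω q` remain.
  have h1 : (Finset.univ.filter fun ω : I → A => R (ω p) (ω q)).card =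
      ∑ g : {j // j ≠ q} → A, (Finset.univ.filter fun a' => R (g ⟨p, hpq⟩) a').card := by
    simp only [Finset.card_filter]
    rw [← Fintype.sum_prod_type_right'
      (f := fun (a' : A) (g : {j // j ≠ q} → A) => if R (g ⟨p, hpq⟩) a' then 1 else 0), ← φ.sum_comp]
    rfl
  rw [h1, Fintype.card_congr φ, Fintype.card_prod, mul_comm (Fintype.card A), ← mul_assoc]
  gcongr
  refine (Finset.sum_le_card_nsmul _ _ r fun g _ => hR _).trans (le_of_eq ?_)
  rw [Finset.card_univ, smul_eq_mul, mul_comm]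

section Counting
variable {W ι : Type} [Fintype W] [DecidableEq ι] {m T : ℕ}

theorem card_filter_same_block_le {b : W → ι} {r : ℕ}
    (hr : ∀ v, (Finset.univ.filter fun u => b v = b u).card ≤ r) {p q : Fin m × Fin T} (hpq : p ≠ q) :
    (Finset.univ.filter fun ω : Fin m × Fin T → W × Bool × Bool => b (ω p).1 = b (ω q).1).card *
        Fintype.card W ≤ r * Fintype.card (Fin m × Fin T → W × Bool × Bool) := by
  -- The factor `4` counts the two free bits of a seed.
  have := card_filter_rel_mul_le (fun a a' : W × Bool × Bool => b a.1 = b a'.1) (r := r * 4) (fun a => by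
    have : (Finset.univ.filter fun a' : W × Bool × Bool => b a.1 = b a'.1) =
        (Finset.univ.filter fun u => b a.1 = b u) ×ˢ Finset.univ := by
      ext; simp
    rw [this, Finset.card_product]
    exact Nat.mul_le_mul (hr _) (by simp)) hpq
  simp only [Fintype.card_prod, Fintype.card_bool] at this
  refine Nat.le_of_mul_le_mul_right (c := 4) ?_ (by norm_num)
  linarith

/-- The event fixes the jump bit of the `L` seeds at the times `t - L + 1, …, t`, each of which
halves the count. -/
theorem card_filter_long_le (L : ℕ) (p : Fin m × Fin T) :
    (Finset.univ.filter fun ω : Fin m × Fin T → W × Bool × Bool =>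
        L + lastJump (directions fun t => ω (p.1, t)) p.2 ≤ p.2).card * 2 ^ L ≤
      Fintype.card (Fin m × Fin T → W × Bool × Bool) := by
  classical
  obtain ⟨i, t, ht⟩ := p
  by_cases hLt : L ≤ t
  swap
  · rw [Finset.filter_false_of_mem]
    · simp
    · intro ω _
      simp only
      omega
  let win : Finset (Fin m × Fin T) :=
    (Finset.univ : Finset (Fin L)).image fun k : Fin L => (i, ⟨t - k.val, by omega⟩)
  have hwin : win.card = L := by
    rw [Finset.card_image_of_injective, Finset.card_univ, Fintype.card_fin]
    intro k k' h
    simp only [Prod.mk.injEq, Fin.mk.injEq, true_and] at h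
    have := k.2
    have := k'.2
    ext
    omega
  let J : Fin m × Fin T → Finset (W × Bool × Bool) := fun q =>
    if q ∈ win then Finset.univ ×ˢ {false} ×ˢ Finset.univ else Finset.univ
  have hsub : (Finset.univ.filter fun ω : Fin m × Fin T → W × Bool × Bool =>
        L + lastJump (directions fun t => ω (i, t)) t ≤ t) ⊆ Fintype.piFinset J := by
    intro ω hω
    simp only [Finset.mem_filter, Finset.mem_univ, true_and] at hω
    rw [Fintype.mem_piFinset]
    intro q
    by_cases hq : q ∈ win
    · obtain ⟨k, _, rfl⟩ := Finset.mem_image.1 hq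
      have := not_jump_of_lastJump_lt (directions fun t => ω (i, t)) (t := t) (j := t - k)
        (by have := k.2; omega) (by omega)
      rw [directions, dif_pos (by omega)] at this
      simp only [J, if_pos hq]
      exact Finset.mem_product.2 ⟨Finset.mem_univ _,
        Finset.mem_product.2 ⟨Finset.mem_singleton.2 this, Finset.mem_univ _⟩⟩
    · simp [J, hq]
  have hJ : (Fintype.piFinset J).card * 2 ^ L = Fintype.card (Fin m × Fin T → W × Bool × Bool) := by
    have h2 : (2 : ℕ) ^ L = ∏ q, if q ∈ win then 2 else 1 := by
      rw [Finset.prod_ite_mem, Finset.univ_inter, Finset.prod_const, hwin]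
    rw [Fintype.card_piFinset, h2, ← Finset.prod_mul_distrib, Fintype.card_fun,
      ← Finset.card_univ (α := Fin m × Fin T), ← Finset.prod_const]
    refine Finset.prod_congr rfl fun q _ => ?_
    by_cases hq : q ∈ win
    · simp [J, hq, Finset.card_product]
      ring
    · simp [J, hq]
  rw [← hJ]
  exact Nat.mul_le_mul_right _ (Finset.card_le_card hsub)

-- Union bound over the `m T` positions for long runs and over at most `(m T) ^ 2` pairs of seeds
-- for shared blocks.
open Classical in
theorem card_filter_isSpread_ge [Nonempty W] (L : ℕ) {b : W → ι} {r : ℕ}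
    (hr : ∀ v, (Finset.univ.filter fun u => b v = b u).card ≤ r) :
    1 - (m * T : ℝ) / 2 ^ L - (m * T : ℝ) ^ 2 * r / Fintype.card W ≤
      ((Finset.univ.filter fun ω : Fin m × Fin T → W × Bool × Bool => IsSpread L b ω).card : ℝ) /
        Fintype.card (Fin m × Fin T → W × Bool × Bool) := by
  set Ω := Fin m × Fin T → W × Bool × Bool
  let pairs : Finset ((Fin m × Fin T) × (Fin m × Fin T)) := Finset.univ.filter fun x => x.1 ≠ x.2
  let C : (Fin m × Fin T) × (Fin m × Fin T) → Finset Ω := fun x =>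
    Finset.univ.filter fun ω => b (ω x.1).1 = b (ω x.2).1
  let B : Fin m × Fin T → Finset Ω := fun p =>
    Finset.univ.filter fun ω => L + lastJump (directions fun t => ω (p.1, t)) p.2 ≤ p.2
  have hcover : (Finset.univ : Finset Ω) ⊆ (Finset.univ.filter fun ω => IsSpread L b ω) ∪
      (Finset.univ.biUnion B ∪ pairs.biUnion C) := by
    intro ω _
    by_cases h : IsSpread L b ω
    · simp [h]
    · rw [IsSpread, not_and_or] at h
      push Not at h
      rcases h with ⟨p, q, hpq, h⟩ | ⟨p, h⟩
      · refine Finset.mem_union_right _ (Finset.mem_union_right _ ?_)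
        exact Finset.mem_biUnion.2 ⟨(p, q), by simp [pairs, hpq], by simp [C, h]⟩
      · refine Finset.mem_union_right _ (Finset.mem_union_left _ ?_)
        exact Finset.mem_biUnion.2 ⟨p, by simp, by simp [B, h]⟩
  have hΩ : (0 : ℝ) < Fintype.card Ω := by exact_mod_cast Fintype.card_pos
  have hW : (0 : ℝ) < Fintype.card W := by exact_mod_cast Fintype.card_pos
  have hB : ∀ p, ((B p).card : ℝ) ≤ Fintype.card Ω / 2 ^ L := by
    intro p
    rw [le_div_iff₀ (by positivity)]
    exact_mod_cast card_filter_long_le L p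
  have hC : ∀ x ∈ pairs, ((C x).card : ℝ) ≤ r * Fintype.card Ω / Fintype.card W := by
    intro x hx
    rw [le_div_iff₀ hW]
    exact_mod_cast card_filter_same_block_le hr (Finset.mem_filter.1 hx).2
  have hI : (Fintype.card (Fin m × Fin T) : ℝ) = m * T := by simp
  have hBs : ((Finset.univ.biUnion B).card : ℝ) ≤ (m * T) * (Fintype.card Ω / 2 ^ L) := by
    calc ((Finset.univ.biUnion B).card : ℝ) ≤ ∑ p, ((B p).card : ℝ) := by
          exact_mod_cast Finset.card_biUnion_le
      _ ≤ ∑ _p : Fin m × Fin T, (Fintype.card Ω / 2 ^ L : ℝ) := Finset.sum_le_sum fun p _ => hB p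
      _ = _ := by rw [Finset.sum_const, Finset.card_univ, nsmul_eq_mul, hI]
  have hCs : ((pairs.biUnion C).card : ℝ) ≤ (m * T) ^ 2 * (r * Fintype.card Ω / Fintype.card W) := by
    calc ((pairs.biUnion C).card : ℝ) ≤ ∑ x ∈ pairs, ((C x).card : ℝ) := by
          exact_mod_cast Finset.card_biUnion_le
      _ ≤ ∑ _x ∈ pairs, (r * Fintype.card Ω / Fintype.card W : ℝ) := Finset.sum_le_sum hC
      _ = pairs.card * (r * Fintype.card Ω / Fintype.card W : ℝ) := by
          rw [Finset.sum_const, nsmul_eq_mul]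
      _ ≤ _ := by
          gcongr
          rw [sq, ← hI, ← Nat.cast_mul, ← Fintype.card_prod]
          exact_mod_cast Finset.card_le_univ _
  have htot : (Fintype.card Ω : ℝ) ≤
      ((Finset.univ.filter fun ω : Ω => IsSpread L b ω).card : ℝ) +
        (((Finset.univ.biUnion B).card : ℝ) + ((pairs.biUnion C).card : ℝ)) := by
    have h1 := Finset.card_le_card hcover
    have h2 := h1.trans (Finset.card_union_le _ _)
    have h3 := h2.trans (Nat.add_le_add_left (Finset.card_union_le _ _) _)
    rw [Finset.card_univ] at h3
    exact_mod_cast h3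
  rw [le_div_iff₀ hΩ]
  have e1 : (1 - (m * T : ℝ) / 2 ^ L - (m * T : ℝ) ^ 2 * r / Fintype.card W) * Fintype.card Ω =
      Fintype.card Ω - (m * T) * (Fintype.card Ω / 2 ^ L) -
        (m * T) ^ 2 * (r * Fintype.card Ω / Fintype.card W) := by
    field_simp
  rw [e1]
  linarith

end Counting

/-! ### Translations and the final choice of parameters. -/

section Translation
variable {W V : Type} [AddCommGroup V]

theorem exists_perm_translation (e : W ≃ V) (g : V) : ∃ π : Equiv.Perm W, ∀ w, e (π w) = e w + g :=
  ⟨e.trans ((Equiv.addRight g).trans e.symm), fun w => by simp⟩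

theorem zpow_translation_apply {e : W ≃ V} {g : V} {π : Equiv.Perm W} (h : ∀ w, e (π w) = e w + g)
    (k : ℤ) (w : W) : e ((π ^ k) w) = e w + k • g := by
  induction k generalizing w with
  | zero => simp
  | succ k ih => rw [zpow_add, Equiv.Perm.mul_apply, zpow_one, ih, h, add_smul, one_smul]; abel
  | pred k ih =>
    have h' : e (π⁻¹ w) = e w - g := by
      rw [eq_sub_iff_add_eq, ← h, Equiv.Perm.inv_def, Equiv.apply_symm_apply]
    rw [zpow_sub, zpow_one, Equiv.Perm.mul_apply, ih, h', sub_smul, one_smul]; abel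

/-- The hypothesis `n ∣ 2` covers both translations: `2 * L ∣ k * n` implies `2 * L ∣ k * 2`, hence
`L ∣ k`. -/
theorem eq_zero_of_zpow_translation_apply_eq {K L : ℕ} {e : W ≃ ZMod K × ZMod (2 * L)} {n : ℕ} (hn : n ∣ 2)
    {π : Equiv.Perm W} (h : ∀ w, e (π w) = e w + (0, (n : ZMod (2 * L)))) (w : W) (k : ℤ)
    (hk : |k| < L) (hw : (π ^ k) w = w) : k = 0 := by
  have h1 := zpow_translation_apply h k w
  rw [hw, left_eq_add] at h1
  have h2 : ((k * n : ℤ) : ZMod (2 * L)) = 0 := by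
    simpa using congrArg Prod.snd h1
  rw [ZMod.intCast_zmod_eq_zero_iff_dvd] at h2
  have h3 : ((2 * L : ℕ) : ℤ) ∣ k * 2 := h2.trans (mul_dvd_mul_left k (by exact_mod_cast hn))
  push_cast at h3
  rw [mul_comm k 2] at h3
  have h4 : (L : ℤ) ∣ k := (mul_dvd_mul_iff_left two_ne_zero).1 h3
  exact Int.eq_zero_of_abs_lt_dvd h4 hk

end Translation

/-- Few short walks do not separate the translations by `(0, 2)` and `(0, 1)`, whose cycles have lengths
`L` and `2 L`. -/
theorem successProb_add_le_of_translations {K L : ℕ} (hK : 0 < K) (hL : 0 < L) {N m T : ℕ}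
    (e : Fin N ≃ ZMod K × ZMod (2 * L)) {π₁ π₂ : Equiv.Perm (Fin N)}
    (h₁ : ∀ w, e (π₁ w) = e w + (0, 2)) (h₂ : ∀ w, e (π₂ w) = e w + (0, 1))
    (alg : TranscriptAlgorithm m T N) [IsMarkovKernel alg] {ε : ℝ} (hε : 0 ≤ ε) (hεL : 4 * ε * L < 1) :
    successProb alg (permGraph 2 zero_le_two π₁) ε + successProb alg (permGraph 2 zero_le_two π₂) ε ≤
      1 + (m * T : ℝ) / 2 ^ L + (m * T : ℝ) ^ 2 / K := by
  classical
  have : NeZero K := ⟨hK.ne'⟩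
  have : NeZero (2 * L) := ⟨by omega⟩
  have hK' : (0 : ℝ) < K := by exact_mod_cast hK
  have hL' : (0 : ℝ) < L := by exact_mod_cast hL
  have : Nonempty (Fin N) := ⟨e.symm 0⟩
  have hcard : (Fintype.card (Fin N) : ℝ) = K * (2 * L) := by rw [Fintype.card_congr e]; simp
  obtain ⟨f, hf, hfB, hsep⟩ := exists_lipschitz_separating_permGraph hK hL 2 zero_le_two π₁ π₂ e h₁ h₂
  let b : Fin N → ZMod K := fun w => (e w).1
  have hb₁ : ∀ v, b (π₁ v) = b v := fun v => by simp [b, h₁]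
  have hb₂ : ∀ v, b (π₂ v) = b v := fun v => by simp [b, h₂]
  have ho₁ := fun v k => eq_zero_of_zpow_translation_apply_eq (n := 2) (dvd_refl 2) (by simpa using h₁) v k
  have ho₂ := fun v k => eq_zero_of_zpow_translation_apply_eq (n := 1) (one_dvd 2) (by simpa using h₂) v k
  have hr : ∀ v, (Finset.univ.filter fun u => b v = b u).card ≤ 2 * L := by
    intro v
    calc (Finset.univ.filter fun u => b v = b u).card
        ≤ (Finset.univ : Finset (ZMod (2 * L))).card := by
          refine Finset.card_le_card_of_injOn (fun u => (e u).2) (fun _ _ => Finset.mem_univ _) ?_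
          intro u hu u' hu' huu'
          simp only [Finset.coe_filter, Finset.mem_univ, true_and, Set.mem_ofPred_eq] at hu hu'
          exact e.injective (Prod.ext (hu.symm.trans hu') huu')
      _ = 2 * L := by rw [Finset.card_univ, ZMod.card]
  let good : Finset (Fin m × Fin T → Fin N × Bool × Bool) := Finset.univ.filter fun ω => IsSpread L b ω
  have hgood : 1 - (m * T : ℝ) / 2 ^ L - (m * T : ℝ) ^ 2 / K ≤
      (good.card : ℝ) / Fintype.card (Fin m × Fin T → Fin N × Bool × Bool) := by
    refine le_trans (le_of_eq ?_) (card_filter_isSpread_ge L hr)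
    rw [hcard]
    push_cast
    field_simp
  let h : Equiv.Perm (Fin N) → (Fin m × Fin T → Fin N × Bool × Bool) → Fin m × Fin T → Fin N :=
    fun π ω p => position π (fun t => ω (p.1, t)) p.2
  have hQ : ∀ S : Fin m → Fin T → Fin N, relabeledMass (h π₁) good S = relabeledMass (h π₂) good S := by
    refine relabeledMass_eq_of_eq_iff_eq _ _ _ fun ω hω p q => ?_
    have hω' : IsSpread L b ω := (Finset.mem_filter.1 hω).2
    exact (hω'.position_eq_iff hb₁ ho₁ p q).trans (hω'.position_eq_iff hb₂ ho₂ p q).symm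
  have hone : ∀ π : Equiv.Perm (Fin N),
      ∑ S : Fin m → Fin T → Fin N, (permGraph 2 zero_le_two π).transcriptProb S = 1 := by
    intro π
    simp only [transcriptProb_permGraph]
    rw [sum_relabeledMass, Finset.card_univ, div_self]
    exact_mod_cast Fintype.card_ne_zero
  have := successProb_add_le alg (permGraph 2 zero_le_two π₁) (permGraph 2 zero_le_two π₂) hε hf hfB
    (by
      rw [hsep, lt_div_iff₀ (by positivity)]
      linarith)
    (relabeledMass (h π₁) good) (relabeledMass_nonneg _ _)
    (fun S => by
      rw [transcriptProb_permGraph]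
      exact relabeledMass_mono _ (Finset.subset_univ _) S)
    (fun S => by
      rw [transcriptProb_permGraph, hQ]
      exact relabeledMass_mono _ (Finset.subset_univ _) S)
    (hone π₁) (hone π₂)
  rw [sum_relabeledMass] at this
  linarith

/-- Empty transcripts do not separate the two graphs on two vertices in which every vertex has a single
edge. -/
theorem successProb_add_le_one {m T : ℕ} (hmT : m * T = 0) (alg : TranscriptAlgorithm m T 2)
    [IsMarkovKernel alg] {ε : ℝ} (hε : 0 ≤ ε) (hε' : ε < 1 / 2) :
    ∃ G₁ G₂ : WeightedGraph (Fin 2), successProb alg G₁ ε + successProb alg G₂ ε ≤ 1 := by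
  -- Here `K = L = 1`: two self-loops against a single edge. Without mixing (`c = 0`) the separation
  -- is `1`, which is enough for every `ε < 1 / 2`.
  let e : Fin 2 ≃ ZMod 1 × ZMod (2 * 1) := Fintype.equivOfCardEq (by simp)
  obtain ⟨π₁, h₁⟩ := exists_perm_translation e (0, 2)
  obtain ⟨π₂, h₂⟩ := exists_perm_translation e (0, 1)
  obtain ⟨f, hf, hfB, hsep⟩ :=
    exists_lipschitz_separating_permGraph one_pos one_pos 0 le_rfl π₁ π₂ e h₁ h₂
  have hprob : ∀ (G : WeightedGraph (Fin 2)) (S : Fin m → Fin T → Fin 2), G.transcriptProb S = 1 := by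
    intro G S
    have hp : (Fintype.card (Equiv.Perm (Fin 2)) : ℝ) ≠ 0 := by exact_mod_cast Fintype.card_ne_zero
    have hw : ∀ σ : Equiv.Perm (Fin 2), ∏ i, G.walkProb (fun t => σ.symm (S i t)) = 1 := by
      intro σ
      rcases Nat.mul_eq_zero.1 hmT with rfl | rfl
      · simp
      · simp [WeightedGraph.walkProb]
    simp only [WeightedGraph.transcriptProb, hw, Finset.sum_const, Finset.card_univ, nsmul_eq_mul, mul_one]
    exact inv_mul_cancel₀ hp
  have hcard : Fintype.card (Fin m → Fin T → Fin 2) = 1 := by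
    simp only [Fintype.card_fun, Fintype.card_fin, ← pow_mul]
    rw [mul_comm, hmT, pow_zero]
  have hone : ∀ G : WeightedGraph (Fin 2), ∑ S : Fin m → Fin T → Fin 2, G.transcriptProb S = 1 := by
    intro G
    simp only [hprob, Finset.sum_const, Finset.card_univ, hcard, one_smul]
  refine ⟨permGraph 0 le_rfl π₁, permGraph 0 le_rfl π₂, ?_⟩
  have := successProb_add_le alg (permGraph 0 le_rfl π₁) (permGraph 0 le_rfl π₂) hε hf hfB
    (by rw [hsep]; norm_num; linarith) (fun S => 1) (fun S => zero_le_one) (fun S => (hprob _ S).ge)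
    (fun S => (hprob _ S).ge) (hone _) (hone _)
  simp only [Finset.sum_const, Finset.card_univ, hcard, one_smul] at this
  linarith

theorem theorem2 (ε : ℝ) (hε_pos : 0 < ε) (hε_lt : ε < 1 / 2) (m T : ℕ)
    (alg : (N : ℕ) → TranscriptAlgorithm m T N) (halg : ∀ N, IsMarkovKernel (alg N))
    (hsuccess : ∀ N : ℕ, 0 < N → ∀ G : WeightedGraph (Fin N), 3 / 4 < successProb (alg N) G ε) :
    1 / 16 * (2 : ℝ) ^ (1 / (4 * ε)) < (m : ℝ) * (T : ℝ) := by
  by_contra! hle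
  rcases Nat.eq_zero_or_pos (m * T) with hmT | hmT
  · obtain ⟨G₁, G₂, h⟩ := successProb_add_le_one hmT (alg 2) hε_pos.le hε_lt
    have := hsuccess 2 two_pos G₁
    have := hsuccess 2 two_pos G₂
    linarith
  set x := 1 / (4 * ε) with hx
  have hmT' : (1 : ℝ) ≤ m * T := by exact_mod_cast hmT
  -- Since `m T ≥ 1`, the negated bound forces `2 ^ x ≥ 16`.
  have hx4 : 4 ≤ x := by
    have : (2 : ℝ) ^ (4 : ℝ) ≤ 2 ^ x := by norm_num; linarith
    exact (Real.rpow_le_rpow_left_iff one_lt_two).1 this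
  -- `L` is the largest integer strictly below `x`. Strictness gives `4 * ε * L < 1`, while `2 ^ L ≥
  -- 2 ^ x / 2 ≥ 8 m T` accounts for the constant `16`.
  obtain ⟨L, hL⟩ : ∃ L, ⌈x⌉₊ = L + 1 :=
    Nat.exists_eq_succ_of_ne_zero (Nat.ceil_pos.2 (by linarith)).ne'
  have hLx : (L : ℝ) < x := Nat.lt_ceil.1 (by omega)
  have hxL : x ≤ (L + 1 : ℕ) := hL ▸ Nat.le_ceil x
  have hL0 : 0 < L := by
    have : (3 : ℝ) ≤ L := by push_cast at hxL; linarith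
    have : (0 : ℝ) < L := by linarith
    exact_mod_cast this
  have hpow : (m * T : ℝ) / 2 ^ L ≤ 1 / 8 := by
    have : (2 : ℝ) ^ x ≤ 2 ^ (L + 1) := by
      rw [← Real.rpow_natCast]
      exact Real.rpow_le_rpow_of_exponent_le one_le_two hxL
    rw [pow_succ] at this
    rw [div_le_iff₀ (by positivity)]
    linarith
  have hεL : 4 * ε * L < 1 := by
    rw [hx, lt_div_iff₀ (by positivity)] at hLx
    linarith
  -- This many blocks bring the collision term down to `1/8`, for a total of `1 + 1/8 + 1/8 < 3/2`.
  set K := 8 * (m * T) ^ 2 with hK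
  have hK0 : 0 < K := by positivity
  have hKT : (m * T : ℝ) ^ 2 / K ≤ 1 / 8 := by
    rw [hK]
    push_cast
    rw [div_le_iff₀ (by positivity)]
    linarith
  have : NeZero K := ⟨hK0.ne'⟩
  have : NeZero (2 * L) := ⟨by omega⟩
  let e : Fin (K * (2 * L)) ≃ ZMod K × ZMod (2 * L) := Fintype.equivOfCardEq (by simp)
  obtain ⟨π₁, h₁⟩ := exists_perm_translation e (0, 2)
  obtain ⟨π₂, h₂⟩ := exists_perm_translation e (0, 1)
  have := halg (K * (2 * L))
  have h := successProb_add_le_of_translations hK0 hL0 e h₁ h₂ (alg _) hε_pos.le hεL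
  have := hsuccess (K * (2 * L)) (by positivity) (permGraph 2 zero_le_two π₁)
  have := hsuccess (K * (2 * L)) (by positivity) (permGraph 2 zero_le_two π₂)
  linarith
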